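/- Let $p$ be a prime number and let $G$ be a profinite group. Write $H^i(G)=H^i(G,\mathbb{Z}/p)$ for the continuous cohomology groups with trivial action on $\mathbb{Z}/p$ (so $H^1(G)$ is the group of continuous homomorphisms $G\to\mathbb{Z}/p$), let $\cup\colon H^1(G)\otimes_{\mathbb{Z}}H^1(G)\to H^2(G)$ be the homomorphism given by the cup product, and let $\beta_G\colon H^1(G)\to H^2(G)$ be the Bockstein homomorphism, i.e. the connecting homomorphism of the exact sequence $0\to\mathbb{Z}/p\to\mathbb{Z}/p^2\to\mathbb{Z}/p\to0$ of trivial $G$-modules. Suppose that $G$ has Galois relation type, that is, (i) the kernel of $\cup\colon H^1(G)\otimes_{\mathbb{Z}}H^1(G)\to H^2(G)$ is generated by elements of the form $\psi\otimes\psi'$ with $\psi,\psi'\in H^1(G)$; and (ii) there exists $\xi\in H^1(G)$ such that $\psi\cup\xi+\beta_G(\psi)=0$ for every $\psi\in H^1(G)$. Let $G^{(1)}=G$ and, for $i\ge1$, let $G^{(i+1)}=(G^{(i)})^p[G^{(i)},G]$ be the closed subgroup of $G$ generated by all $h^p$ and all $[h,g]=h^{-1}g^{-1}hg$ with $h\in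 G^{(i)}$, $g\in G$. Assume that $G/G^{(3)}$ is nonabelian. Then: (a) If $p\ne2$, the modular group $M_{p^3}=\langle r,s\mid r^{p^2}=s^p=1,\ [r,s]=r^p\rangle$ of order $p^3$ is a quotient of $G/G^{(3)}$ (by an open normal subgroup). (b) If $p=2$, the dihedral group $D_4$ of order $8$ is a quotient of $G/G^{(3)}$ (by an open normal subgroup). -/

import Mathlib

open scoped TensorProduct

noncomputable section

namespace ProfiniteCohomology

/-! ### Low-degree continuous cohomology with coefficients in the trivial module `ℤ/q` -/

/-- `H¹(G, ℤ/q) = Hom(G, ℤ/q)`: the group of continuous homomorphisms `G → ℤ/q`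
(with `ℤ/q` discrete), under pointwise addition. -/
abbrev H1 (q : ℕ) (G : Type*) [Group G] [TopologicalSpace G] : Type _ :=
  Additive G →ₜ+ ZMod q

/-- The value `ψ(g)` of a class `ψ ∈ H¹(G, ℤ/q)`. -/
def H1.val {q : ℕ} {G : Type*} [Group G] [TopologicalSpace G] (ψ : H1 q G) (g : G) : ZMod q :=
  ψ (Additive.ofMul g)

theorem H1.val_mul {q : ℕ} {G : Type*} [Group G] [TopologicalSpace G] (ψ : H1 q G) (g h : G) :
    ψ.val (g * h) = ψ.val g + ψ.val h :=
  map_add ψ (Additive.ofMul g) (Additive.ofMul h)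

theorem H1.continuous_val {q : ℕ} {G : Type*} [Group G] [TopologicalSpace G] (ψ : H1 q G) :
    Continuous ψ.val :=
  ψ.continuous_toFun.comp continuous_ofMul

/-- The group `Z²(G, ℤ/q)` of continuous inhomogeneous 2-cocycles, for the trivial action. -/
def Z2 (q : ℕ) (G : Type*) [Group G] [TopologicalSpace G] : AddSubgroup C(G × G, ZMod q) where
  carrier := {f | ∀ g h k : G, f (h, k) + f (g, h * k) = f (g * h, k) + f (g, h)}
  zero_mem' := by intro g h k; simp
  add_mem' := by
    intro a b ha hb g h k
    have h1 := ha g h k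
    have h2 := hb g h k
    simp only [ContinuousMap.add_apply]
    linear_combination h1 + h2
  neg_mem' := by
    intro a ha g h k
    have h1 := ha g h k
    simp only [ContinuousMap.neg_apply]
    linear_combination -h1

/-- The group `B²(G, ℤ/q)` of 2-coboundaries of continuous 1-cochains. -/
def B2 (q : ℕ) (G : Type*) [Group G] [TopologicalSpace G] : AddSubgroup C(G × G, ZMod q) where
  carrier := {f | ∃ u : C(G, ZMod q), ∀ g h : G, f (g, h) = u h - u (g * h) + u g}
  zero_mem' := ⟨0, by intro g h; simp⟩
  add_mem' := by
    rintro a b ⟨u, hu⟩ ⟨v, hv⟩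
    refine ⟨u + v, fun g h => ?_⟩
    simp only [ContinuousMap.add_apply, hu, hv]
    ring
  neg_mem' := by
    rintro a ⟨u, hu⟩
    refine ⟨-u, fun g h => ?_⟩
    simp only [ContinuousMap.neg_apply, hu]
    ring

/-- `H²(G, ℤ/q) = Z²/B²` (every coboundary is a cocycle, see `B2_le_Z2`). -/
abbrev H2 (q : ℕ) (G : Type*) [Group G] [TopologicalSpace G] : Type _ :=
  Z2 q G ⧸ (B2 q G).addSubgroupOf (Z2 q G)

theorem B2_le_Z2 (q : ℕ) (G : Type*) [Group G] [TopologicalSpace G] : B2 q G ≤ Z2 q G := by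
  rintro f ⟨u, hu⟩ g h k
  simp only [hu, mul_assoc]
  ring

/-- The cocycle `(g, h) ↦ ψ(g) ψ'(h)`. -/
def cupCocycle {q : ℕ} {G : Type*} [Group G] [TopologicalSpace G] (ψ ψ' : H1 q G) : Z2 q G :=
  ⟨⟨fun x => ψ.val x.1 * ψ'.val x.2,
      (ψ.continuous_val.comp continuous_fst).mul (ψ'.continuous_val.comp continuous_snd)⟩, by
    intro g h k
    simp only [ContinuousMap.coe_mk, H1.val_mul]
    ring⟩

/-- The cup product `H¹(G, ℤ/q) × H¹(G, ℤ/q) → H²(G, ℤ/q)`, as a biadditive map. -/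
def cup (q : ℕ) (G : Type*) [Group G] [TopologicalSpace G] : H1 q G →+ H1 q G →+ H2 q G :=
  AddMonoidHom.mk'
    (fun ψ => AddMonoidHom.mk' (fun ψ' => (QuotientAddGroup.mk (cupCocycle ψ ψ') : H2 q G)) (by
      intro a b
      rw [← QuotientAddGroup.mk_add]
      congr 1
      ext x
      exact mul_add _ _ _)) (by
    intro a b
    ext ψ'
    change (QuotientAddGroup.mk (cupCocycle (a + b) ψ') : H2 q G) =
      QuotientAddGroup.mk (cupCocycle a ψ') + QuotientAddGroup.mk (cupCocycle b ψ')
    rw [← QuotientAddGroup.mk_add]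
    congr 1
    ext x
    exact add_mul _ _ _)

/-- The homomorphism `H¹(G, ℤ/q) ⊗_ℤ H¹(G, ℤ/q) → H²(G, ℤ/q)` induced by the cup product. -/
def cupTensor (q : ℕ) (G : Type*) [Group G] [TopologicalSpace G] :
    H1 q G ⊗[ℤ] H1 q G →+ H2 q G :=
  TensorProduct.liftAddHom (cup q G) (by
    intro n a b
    simp)

/-- The carry function on `ℤ/q`: the sum of the representatives of `a` and `b` in `{0, …, q - 1}`
is `q * carry a b` plus the representative of `a + b`. It is the 2-cocycle of the extension
`0 → ℤ/q → ℤ/q² → ℤ/q → 0` given by the set-theoretic section `a ↦ ZMod.val a`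
(see `carry_spec`). -/
def carry {q : ℕ} (a b : ZMod q) : ℕ := (a.val + b.val) / q

theorem carry_add {q : ℕ} [NeZero q] (a b : ZMod q) :
    q * carry a b + (a + b).val = a.val + b.val := by
  rw [carry, ZMod.val_add]
  exact Nat.div_add_mod _ _

/-- The map `1 ↦ q` from `ℤ/q` to `ℤ/q²` takes the carry of `a` and `b` to the coboundary
`s(b) - s(a + b) + s(a)` of the section `s : ℤ/q → ℤ/q²`, `s(a) = ZMod.val a`. -/
theorem carry_spec {q : ℕ} [NeZero q] (a b : ZMod q) :
    ((q * carry a b : ℕ) : ZMod (q * q)) = (b.val : ZMod (q * q)) - (a + b).val + a.val := by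
  have h := congrArg (Nat.cast : ℕ → ZMod (q * q)) (carry_add a b)
  push_cast at h ⊢
  linear_combination h

theorem carry_cocycle {q : ℕ} [NeZero q] (a b c : ZMod q) :
    carry b c + carry a (b + c) = carry (a + b) c + carry a b := by
  have h1 := carry_add a b
  have h2 := carry_add (a + b) c
  have h3 := carry_add b c
  have h4 := carry_add a (b + c)
  rw [← add_assoc] at h4
  refine Nat.eq_of_mul_eq_mul_left (Nat.pos_of_ne_zero (NeZero.ne q)) ?_
  rw [mul_add, mul_add]
  omega

/-- The cocycle `(g, h) ↦ carry(ψ(g), ψ(h))`. -/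
def bocksteinCocycle {q : ℕ} [NeZero q] {G : Type*} [Group G] [TopologicalSpace G]
    (ψ : H1 q G) : Z2 q G :=
  ⟨⟨fun x => (carry (ψ.val x.1) (ψ.val x.2) : ZMod q),
      (continuous_of_discreteTopology
        (f := fun y : ZMod q × ZMod q => (carry y.1 y.2 : ZMod q))).comp
        ((ψ.continuous_val.comp continuous_fst).prodMk
          (ψ.continuous_val.comp continuous_snd))⟩, by
    intro g h k
    simp only [ContinuousMap.coe_mk, H1.val_mul]
    exact_mod_cast congrArg (Nat.cast : ℕ → ZMod q)
      (carry_cocycle (ψ.val g) (ψ.val h) (ψ.val k))⟩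

/-- The Bockstein map `β_G : H¹(G, ℤ/q) → H²(G, ℤ/q)`: the connecting homomorphism of the
exact sequence `0 → ℤ/q → ℤ/q² → ℤ/q → 0` of trivial `G`-modules. A class `ψ` is lifted to the
continuous cochain `g ↦ ZMod.val (ψ g)` in `ℤ/q²`, whose coboundary is `q` times the carry
cocycle. -/
def bockstein {q : ℕ} [NeZero q] {G : Type*} [Group G] [TopologicalSpace G] (ψ : H1 q G) :
    H2 q G :=
  QuotientAddGroup.mk (bocksteinCocycle ψ)

/-- A profinite group `G` has Galois relation type with respect to a prime power `q`. -/
structure HasGaloisRelationType (q : ℕ) [NeZero q] (G : Type*) [Group G] [TopologicalSpace G] :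
    Prop where
  /-- The kernel of `∪ : H¹(G) ⊗_ℤ H¹(G) → H²(G)` is generated, as an abelian group, by pure
  tensors `ψ ⊗ ψ'`. -/
  ker_cup : ∃ S : Set (H1 q G × H1 q G),
    (cupTensor q G).ker = AddSubgroup.closure ((fun x => x.1 ⊗ₜ[ℤ] x.2) '' S)
  /-- The Bockstein map is, up to sign, the cup product with a fixed class. -/
  bockstein_eq : ∃ ξ : H1 q G, ∀ ψ : H1 q G, cup q G ψ ξ + bockstein ψ = 0
  /-- The reduction map `H¹(G, ℤ/q) → H¹(G, ℤ/m)` is surjective for all `m ∣ q`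
  (that is, for `m = pⁱ` with `0 ≤ i ≤ d` if `q = p ^ d`; the case `m = 1` is trivial). -/
  reduction_surjective : ∀ (m : ℕ) (hm : m ∣ q) (χ : H1 m G), ∃ ψ : H1 q G,
    ∀ g : G, ZMod.castHom hm (ZMod m) (ψ.val g) = χ.val g

end ProfiniteCohomology

/-! ### The descending `q`-central sequence -/

/-- For a subgroup `H` of the topological group `G`, the closed subgroup `H^q [H, G]` of `G`
generated by all `h ^ q` and all `[h, g] = h⁻¹ g⁻¹ h g` with `h ∈ H`, `g ∈ G`. -/
def qCentralStep (q : ℕ) {G : Type*} [Group G] [TopologicalSpace G] [IsTopologicalGroup G]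
    (H : Subgroup G) : Subgroup G :=
  (Subgroup.closure ({x | ∃ h ∈ H, x = h ^ q} ∪
    {x | ∃ h ∈ H, ∃ g : G, x = h⁻¹ * g⁻¹ * h * g})).topologicalClosure

/-- The descending `q`-central sequence `G^(1) = G`, `G^(i+1) = (G^(i))^q [G^(i), G]`
(with the junk value `G^(0) = G`). -/
def descendingCentral (q : ℕ) (G : Type*) [Group G] [TopologicalSpace G] [IsTopologicalGroup G] :
    ℕ → Subgroup G
  | 0 => ⊤
  | 1 => ⊤
  | i + 2 => qCentralStep q (descendingCentral q G (i + 1))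

theorem qCentralStep_normal (q : ℕ) {G : Type*} [Group G] [TopologicalSpace G]
    [IsTopologicalGroup G] (H : Subgroup G) (hH : H.Normal) : (qCentralStep q H).Normal := by
  have hn : (Subgroup.closure ({x | ∃ h ∈ H, x = h ^ q} ∪
      {x | ∃ h ∈ H, ∃ g : G, x = h⁻¹ * g⁻¹ * h * g})).Normal := by
    refine ⟨fun n hn k => ?_⟩
    induction hn using Subgroup.closure_induction with
    | mem x hx =>
      apply Subgroup.subset_closure
      rcases hx with ⟨h, hh, rfl⟩ | ⟨h, hh, g, rfl⟩
      · exact Or.inl ⟨k * h * k⁻¹, hH.conj_mem h hh k, conj_pow.symm⟩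
      · exact Or.inr ⟨k * h * k⁻¹, hH.conj_mem h hh k, k * g * k⁻¹, by group⟩
    | one => simp
    | mul x y _ _ hx hy =>
      have := Subgroup.mul_mem _ hx hy
      simpa [mul_assoc] using this
    | inv x _ hx =>
      have := Subgroup.inv_mem _ hx
      simpa [mul_assoc] using this
  exact Subgroup.is_normal_topologicalClosure _

instance descendingCentral_normal (q : ℕ) (G : Type*) [Group G] [TopologicalSpace G]
    [IsTopologicalGroup G] (i : ℕ) : (descendingCentral q G i).Normal := by
  induction i with
  | zero => exact inferInstanceAs ((⊤ : Subgroup G).Normal)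
  | succ i ih =>
    cases i with
    | zero => exact inferInstanceAs ((⊤ : Subgroup G).Normal)
    | succ i => exact qCentralStep_normal q _ ih

/-! ### The modular group of order `p³` -/

/-- The relators of `⟨r, s | r^(p²) = s^p = 1, [r, s] = r^p⟩` with `[r, s] = r⁻¹ s⁻¹ r s`;
the generators are `r = of 0` and `s = of 1`. -/
def modularRelators (p : ℕ) : Set (FreeGroup (Fin 2)) :=
  let r : FreeGroup (Fin 2) := FreeGroup.of 0
  let s : FreeGroup (Fin 2) := FreeGroup.of 1
  {r ^ (p ^ 2), s ^ p, (r⁻¹ * s⁻¹ * r * s) * (r ^ p)⁻¹}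

/-- The modular group `M_{p³} = ⟨r, s | r^(p²) = s^p = 1, [r, s] = r^p⟩`. -/
abbrev ModularGroupPCubed (p : ℕ) : Type := PresentedGroup (modularRelators p)

/-- The finite (discrete) group `Q` is a quotient of the profinite group `Γ`: it is isomorphic to
`Γ / N` for some open normal subgroup `N`. -/
def IsFiniteQuotient (Γ : Type*) [Group Γ] [TopologicalSpace Γ] (Q : Type*) [Group Q] : Prop :=
  ∃ N : Subgroup Γ, ∃ _ : N.Normal, IsOpen (N : Set Γ) ∧ Nonempty (Γ ⧸ N ≃* Q)

end

/-! Nonabelianness of `G / G^(3)` yields a relation in `H²(G)` that is not symmetric. Take a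
nonabelian finite quotient `Q` of `G / G^(3)` of least order. Its commutators lie in a central
subgroup of order `p`, so they define an alternating form `ω : Q × Q → ℤ/p`, and `ω(x, y) = B(x, y)
- B(y, x)` with `B` a sum of products of characters. Twisting the multiplication of `Q` by `-B`
makes it abelian of exponent dividing `p²`. A character of the twisted group that is nontrivial on
the commutators is a map `u : Q → ℤ/p²` that is additive up to `p k B`, with `k ≠ 0`. With `ψ = u
mod p`, this says that the tensor `t` of `kB` satisfies `∪t + β(ψ) = 0`, while `t` is not symmetric
(`exists_tensor_of_nonabelian`).

Conversely, for independent `ψ, φ`, the relation `ψ ∪ φ + β(ψ) = 0` gives a surjection onto `M_{p³}`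
(`isFiniteQuotient_modular`), and for `p = 2` the relation `ψ ∪ φ = 0` gives one onto `D₄`
(`isFiniteQuotient_dihedral`).

To find such a pair, let `ξ` be the class with `ψ ∪ ξ + β(ψ) = 0` for all `ψ`. If some `φ` is
independent of `ξ`, use `(φ, ξ)`, or `(φ, ξ + φ)` for `D₄`, since `β(φ) = φ ∪ φ` when `p = 2`.
Otherwise `ψ ⊗ ξ` is symmetric, so `t - ψ ⊗ ξ` is a nonsymmetric element of the kernel of `∪`. Some
generating pure tensor of that kernel then has independent factors; this forces `ξ = 0`, hence `β =
0`, and that pair serves for both groups. -/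

noncomputable section

namespace ProfiniteCohomology


/-! ### Multiplication by `p` from `ℤ/p` to `ℤ/p²` -/

section ZMod

variable (p : ℕ)

/-- The injection `ℤ/p → ℤ/p²`, `1 ↦ p`. -/
def timesP : ZMod p →+ ZMod (p * p) :=
  ZMod.lift p ⟨zmultiplesHom (ZMod (p * p)) (p : ZMod (p * p)), by
    rw [zmultiplesHom_apply, natCast_zsmul, nsmul_eq_mul, ← Nat.cast_mul, ZMod.natCast_self]⟩

/-- The reduction `ℤ/p² → ℤ/p`. -/
def reduceP : ZMod (p * p) →+* ZMod p := ZMod.castHom (dvd_mul_left p p) (ZMod p)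

variable {p}

theorem reduceP_natCast (n : ℕ) : reduceP p n = n := map_natCast _ n

theorem nsmul_timesP (a : ZMod p) : p • timesP p a = 0 := by
  rw [← map_nsmul]; simp

variable [NeZero p]

theorem timesP_apply (a : ZMod p) : timesP p a = p * (a.val : ZMod (p * p)) := by
  conv_lhs => rw [← ZMod.natCast_zmod_val a]
  have := ZMod.lift_coe p ⟨zmultiplesHom (ZMod (p * p)) (p : ZMod (p * p)), by
    rw [zmultiplesHom_apply, natCast_zsmul, nsmul_eq_mul, ← Nat.cast_mul, ZMod.natCast_self]⟩
    (a.val : ℤ)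
  rw [timesP]
  push_cast at this
  rw [this]
  simp [mul_comm]

theorem timesP_eq_zero {a : ZMod p} (h : timesP p a = 0) : a = 0 := by
  rw [timesP_apply, ← Nat.cast_mul, ZMod.natCast_eq_zero_iff] at h
  have h2 := Nat.dvd_of_mul_dvd_mul_left (Nat.pos_of_ne_zero (NeZero.ne p)) h
  rw [← ZMod.natCast_eq_zero_iff, ZMod.natCast_zmod_val] at h2
  exact h2

theorem reduceP_timesP (a : ZMod p) : reduceP p (timesP p a) = 0 := by
  rw [timesP_apply, ← Nat.cast_mul, reduceP_natCast]; simp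

theorem exists_eq_val_add_timesP (x : ZMod (p * p)) :
    ∃ w : ZMod p, x = ((reduceP p x).val : ZMod (p * p)) + timesP p w := by
  refine ⟨((x.val / p : ℕ) : ZMod p), ?_⟩
  have hx : reduceP p x = (x.val : ZMod p) := by
    conv_lhs => rw [← ZMod.natCast_zmod_val x]
    rw [reduceP_natCast]
  have hlt : x.val / p < p := Nat.div_lt_of_lt_mul (ZMod.val_lt x)
  rw [hx, ZMod.val_natCast, timesP_apply, ZMod.val_natCast, Nat.mod_eq_of_lt hlt]
  conv_lhs => rw [← ZMod.natCast_zmod_val x, ← Nat.mod_add_div x.val p]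
  push_cast
  rfl

theorem exists_timesP_of_reduceP {x : ZMod (p * p)} (h : reduceP p x = 0) :
    ∃ w : ZMod p, x = timesP p w := by
  obtain ⟨w, hw⟩ := exists_eq_val_add_timesP x
  exact ⟨w, by simpa [h] using hw⟩

theorem mul_timesP (x : ZMod (p * p)) (a : ZMod p) : x * timesP p a = timesP p (reduceP p x * a) := by
  have hx : reduceP p x = (x.val : ZMod p) := by
    conv_lhs => rw [← ZMod.natCast_zmod_val x]
    rw [reduceP_natCast]
  rw [hx, ← nsmul_eq_mul, map_nsmul, nsmul_eq_mul, ZMod.natCast_zmod_val]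

theorem timesP_carry (a b : ZMod p) : timesP p (carry a b : ZMod p) =
    (b.val : ZMod (p * p)) - (a + b).val + a.val := by
  rw [← carry_spec, ← nsmul_one, map_nsmul, ← Nat.cast_one, timesP_apply]
  rcases eq_or_ne p 1 with rfl | hp
  · have : Subsingleton (ZMod (1 * 1)) := inferInstanceAs (Subsingleton (ZMod 1))
    exact Subsingleton.elim _ _
  · have : Fact (1 < p) := ⟨by have := NeZero.ne p; omega⟩
    simp [ZMod.val_one, mul_comm]

end ZMod

/-! ### Values of classes and tensors; vanishing in `H²` through cochains -/

section Classes

variable {p : ℕ} {G : Type*} [Group G] [TopologicalSpace G]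

theorem H1.val_one (ψ : H1 p G) : ψ.val 1 = 0 := map_zero ψ

theorem H1.val_inv (ψ : H1 p G) (g : G) : ψ.val g⁻¹ = -ψ.val g := map_neg ψ (Additive.ofMul g)

theorem H1.val_pow (ψ : H1 p G) (g : G) (n : ℕ) : ψ.val (g ^ n) = n • ψ.val g :=
  map_nsmul ψ n (Additive.ofMul g)

/-- A class as a multiplicative homomorphism. -/
def H1.toMonoidHom (ψ : H1 p G) : G →* Multiplicative (ZMod p) where
  toFun g := Multiplicative.ofAdd (ψ.val g)
  map_one' := congrArg Multiplicative.ofAdd ψ.val_one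
  map_mul' g h := congrArg Multiplicative.ofAdd (ψ.val_mul g h)

/-- Two classes are independent if some `2 × 2` determinant of their values is nonzero. -/
def Independent (ψ φ : H1 p G) : Prop := ∃ x y : G, ψ.val x * φ.val y ≠ ψ.val y * φ.val x

/-- `cupCocycle` as a biadditive map. -/
def cupCocycleHom (p : ℕ) (G : Type*) [Group G] [TopologicalSpace G] :
    H1 p G →+ H1 p G →+ Z2 p G :=
  AddMonoidHom.mk' (fun ψ => AddMonoidHom.mk' (fun φ => cupCocycle ψ φ) (by
    intro a b; ext x; exact mul_add _ _ _)) (by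
    intro a b; ext φ x; exact add_mul _ _ _)

/-- The 2-cochain `(x, y) ↦ ∑ ψᵢ(x) φᵢ(y)` attached to `∑ ψᵢ ⊗ φᵢ`. -/
def tensorCocycle (p : ℕ) (G : Type*) [Group G] [TopologicalSpace G] :
    H1 p G ⊗[ℤ] H1 p G →+ Z2 p G :=
  TensorProduct.liftAddHom (cupCocycleHom p G) (by
    intro n a b
    simp)

theorem mk_tensorCocycle (t : H1 p G ⊗[ℤ] H1 p G) :
    (QuotientAddGroup.mk (tensorCocycle p G t) : H2 p G) = cupTensor p G t := by
  induction t using TensorProduct.induction_on with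
  | zero => simp
  | tmul ψ φ => rfl
  | add a b ha hb => rw [map_add, map_add, QuotientAddGroup.mk_add, ha, hb]

/-- The value `∑ ψᵢ(x) φᵢ(y)` of a tensor `∑ ψᵢ ⊗ φᵢ`. -/
def tensorEval (x y : G) : H1 p G ⊗[ℤ] H1 p G →+ ZMod p where
  toFun t := (tensorCocycle p G t).1 (x, y)
  map_zero' := by simp
  map_add' := by intro a b; simp

@[simp]
theorem tensorEval_tmul (x y : G) (ψ φ : H1 p G) :
    tensorEval x y (ψ ⊗ₜ φ) = ψ.val x * φ.val y := rfl

theorem mk_eq_zero_iff (f : Z2 p G) : (QuotientAddGroup.mk f : H2 p G) = 0 ↔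
    ∃ u : C(G, ZMod p), ∀ g h : G, f.1 (g, h) = u h - u (g * h) + u g := by
  rw [QuotientAddGroup.eq_zero_iff, AddSubgroup.mem_addSubgroupOf]
  rfl

theorem cup_eq_zero_iff (ψ φ : H1 p G) : cup p G ψ φ = 0 ↔
    ∃ u : C(G, ZMod p), ∀ g h : G, ψ.val g * φ.val h = u h - u (g * h) + u g :=
  mk_eq_zero_iff (cupCocycle ψ φ)

theorem cup_add_bockstein_eq_zero_iff [NeZero p] (ψ φ : H1 p G) :
    cup p G ψ φ + bockstein ψ = 0 ↔ ∃ u : C(G, ZMod p), ∀ g h : G,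
      ψ.val g * φ.val h + (carry (ψ.val g) (ψ.val h) : ZMod p) = u h - u (g * h) + u g :=
  mk_eq_zero_iff (cupCocycle ψ φ + bocksteinCocycle ψ)

/-- Vanishing of all `2 × 2` determinants of a pair says exactly that its pure tensor takes
symmetric values, and symmetry passes to sums. Hypothesis (i) on the kernel of `∪` enters the proof
through this. -/
theorem tensorEval_symm_of_dependent (S : Set (H1 p G × H1 p G))
    (hS : ∀ s ∈ S, ¬ Independent s.1 s.2) {t : H1 p G ⊗[ℤ] H1 p G}
    (ht : t ∈ AddSubgroup.closure ((fun x => x.1 ⊗ₜ[ℤ] x.2) '' S)) (x y : G) :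
    tensorEval x y t = tensorEval y x t := by
  induction ht using AddSubgroup.closure_induction with
  | mem t ht =>
    obtain ⟨s, hs, rfl⟩ := ht
    have := hS s hs
    simp only [Independent, not_exists, not_not] at this
    simpa using this x y
  | zero => simp
  | add a b _ _ ha hb => simp [ha, hb]
  | neg a _ ha => simp [ha]

/-- Independent classes have dual elements. -/
theorem Independent.exists_dual [Fact p.Prime] {ψ φ : H1 p G} (h : Independent ψ φ) (a b : ZMod p) :
    ∃ g : G, ψ.val g = a ∧ φ.val g = b := by
  obtain ⟨x, y, hxy⟩ := h
  set d := ψ.val x * φ.val y - ψ.val y * φ.val x with hd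
  have hd0 : d ≠ 0 := sub_ne_zero.mpr hxy
  -- The exponents are given by Cramer's rule.
  refine ⟨x ^ ((a * φ.val y - b * ψ.val y) / d).val * y ^ ((b * ψ.val x - a * φ.val x) / d).val,
    ?_, ?_⟩
  all_goals
    rw [H1.val_mul, H1.val_pow, H1.val_pow, nsmul_eq_mul, nsmul_eq_mul, ZMod.natCast_zmod_val,
      ZMod.natCast_zmod_val]
    field_simp
    rw [hd]
    ring

end Classes

/-! ### Finite quotients of `G / G^(3)` from homomorphisms on `G` -/

section Quotients

variable {p : ℕ} {G : Type*} [Group G] [TopologicalSpace G] [IsTopologicalGroup G]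

theorem H1.val_eq_zero_of_mem (ψ : H1 p G) {h : G} (hh : h ∈ descendingCentral p G 2) :
    ψ.val h = 0 := by
  have hc : IsClosed (ψ.toMonoidHom.ker : Set G) :=
    (isClosed_discrete ({0} : Set (ZMod p))).preimage ψ.continuous_val
  have hle : descendingCentral p G 2 ≤
      ψ.toMonoidHom.ker := by
    refine Subgroup.topologicalClosure_minimal _ ?_ hc
    rw [Subgroup.closure_le]
    rintro x (⟨h, -, rfl⟩ | ⟨h, -, g, rfl⟩)
    · change ψ.val (h ^ p) = 0
      rw [H1.val_pow]; simp
    · change ψ.val _ = 0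
      simp only [H1.val_mul, H1.val_inv]; ring
  exact hle hh

/-- An open kernel is closed, so it contains `G^(3)` as soon as it contains the algebraic
generators. -/
theorem isFiniteQuotient_of_surjective {Q : Type*} [Group Q] (f : G →* Q)
    (hf : Function.Surjective f) (hopen : IsOpen (f.ker : Set G))
    (hpow : ∀ h ∈ descendingCentral p G 2, f (h ^ p) = 1)
    (hcomm : ∀ h ∈ descendingCentral p G 2, ∀ g, f (h * g) = f (g * h)) :
    IsFiniteQuotient (G ⧸ descendingCentral p G 3) Q := by
  have hle : descendingCentral p G 3 ≤ f.ker := by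
    refine Subgroup.topologicalClosure_minimal _ ?_ (Subgroup.isClosed_of_isOpen _ hopen)
    rw [Subgroup.closure_le]
    rintro x (⟨h, hh, rfl⟩ | ⟨h, hh, g, rfl⟩)
    · exact hpow h hh
    · have : h⁻¹ * g⁻¹ * h * g = (g * h)⁻¹ * (h * g) := by group
      rw [this, SetLike.mem_coe, MonoidHom.mem_ker, map_mul, map_inv, hcomm h hh]
      group
  let F := QuotientGroup.lift (descendingCentral p G 3) f hle
  have hF : Function.Surjective F := QuotientGroup.lift_surjective_of_surjective _ _ hf hle
  refine ⟨F.ker, inferInstance, ?_, ⟨QuotientGroup.quotientKerEquivOfSurjective F hF⟩⟩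
  rw [← (QuotientGroup.isQuotientMap_mk (N := descendingCentral p G 3)).isOpen_preimage]
  exact hopen

end Quotients


/-! ### Homomorphisms onto the modular group -/

section Modular

theorem one_add_natCast_pow (p m : ℕ) : (1 + (p : ZMod (p * p))) ^ m = 1 + p * m := by
  have hp : (p : ZMod (p * p)) * p = 0 := by rw [← Nat.cast_mul, ZMod.natCast_self]
  induction m with
  | zero => simp
  | succ m ih =>
    rw [pow_succ, ih]
    push_cast
    linear_combination (m : ZMod (p * p)) * hp

variable {p : ℕ} {P : Type*} [Group P]

theorem pow_eq_pow_of_cast_eq {q : ℕ} {r : P} (hr : r ^ q = 1) {a b : ℕ}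
    (h : (a : ZMod q) = b) : r ^ a = r ^ b :=
  pow_eq_pow_iff_modEq.mpr (((ZMod.natCast_eq_natCast_iff _ _ _).mp h).of_dvd
    (orderOf_dvd_of_pow_eq_one hr))

theorem pow_mul_pow_of_commutator_eq {r s : P} (hrs : r⁻¹ * s⁻¹ * r * s = r ^ p) (n m : ℕ) :
    r ^ n * s ^ m = s ^ m * r ^ (n * (1 + p) ^ m) := by
  have h1 : s⁻¹ * r * s = r ^ (1 + p) := by
    rw [pow_add, pow_one, ← hrs]; group
  have h2 (k : ℕ) : r ^ k * s = s * r ^ (k * (1 + p)) := by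
    rw [mul_comm k, pow_mul, ← h1]
    have : (s⁻¹ * r * s) ^ k = s⁻¹ * r ^ k * s := by
      simpa using (conj_pow (i := k) (a := s⁻¹) (b := r))
    rw [this]; group
  induction m with
  | zero => simp
  | succ m ih =>
    rw [pow_succ, ← mul_assoc, ih, mul_assoc, h2, pow_succ (1 + p), mul_assoc, mul_assoc]

variable [NeZero p]

/-- Conjugation by `s` raises `r` to the power `1 + p`, and `(1 + p)^c = 1 + pc` modulo `p²`. Moving
`s^c` to the left past `r^x` therefore costs the exponent `p x c`. -/
theorem normal_form_mul {r s : P} (hr : r ^ (p * p) = 1) (hs : s ^ p = 1)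
    (hrs : r⁻¹ * s⁻¹ * r * s = r ^ p) (x y : ZMod (p * p)) (b c : ZMod p) :
    (s ^ b.val * r ^ x.val) * (s ^ c.val * r ^ y.val) =
      s ^ (b + c).val * r ^ (x + y + timesP p (reduceP p x * c)).val := by
  have h1 : s ^ (b + c).val = s ^ (b.val + c.val) :=
    pow_eq_pow_of_cast_eq hs (by simp)
  have h2 : r ^ (x + y + timesP p (reduceP p x * c)).val =
      r ^ (x.val * (1 + p) ^ c.val + y.val) := by
    refine pow_eq_pow_of_cast_eq hr ?_
    rw [ZMod.natCast_zmod_val, ← mul_timesP, timesP_apply]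
    push_cast
    rw [one_add_natCast_pow, ZMod.natCast_zmod_val, ZMod.natCast_zmod_val]
    ring
  rw [h1, h2, pow_add, pow_add, mul_assoc, ← mul_assoc (r ^ _), pow_mul_pow_of_commutator_eq hrs]
  simp only [mul_assoc]

end Modular

section ModularQuotient

variable {p : ℕ} [Fact p.Prime] {G : Type*} [Group G] [TopologicalSpace G] [IsTopologicalGroup G]

/-- A cochain `w` bounding `ψ ∪ φ + β(ψ)` corrects the lift of `ψ` to a map `t : G → ℤ/p²` whose
failure of additivity is `p ψ(g) φ(h)`. This is the cocycle of the normal form `s^b r^x`, so `g ↦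
s^φ(g) r^t(g)` is a homomorphism. -/
theorem isFiniteQuotient_modular {ψ φ : H1 p G} (hind : Independent ψ φ)
    (h : cup p G ψ φ + bockstein ψ = 0) :
    IsFiniteQuotient (G ⧸ descendingCentral p G 3) (ModularGroupPCubed p) := by
  obtain ⟨w, hw⟩ := (cup_add_bockstein_eq_zero_iff ψ φ).mp h
  let t : G → ZMod (p * p) := fun g => ((ψ.val g).val : ZMod (p * p)) - timesP p (w g)
  have htred (g : G) : reduceP p (t g) = ψ.val g := by
    simp [t, reduceP_timesP]
  have ht (g h : G) : t (g * h) = t g + t h + timesP p (ψ.val g * φ.val h) := by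
    have h1 := congrArg (timesP p) (hw g h)
    have h2 := timesP_carry (ψ.val g) (ψ.val h)
    simp only [map_add, map_sub] at h1
    simp only [t, H1.val_mul]
    linear_combination h2 - h1
  have htc : Continuous t :=
    (continuous_of_discreteTopology (f := fun y : ZMod p × ZMod p =>
      (y.1.val : ZMod (p * p)) - timesP p y.2)).comp (ψ.continuous_val.prodMk w.continuous)
  let r : ModularGroupPCubed p := PresentedGroup.of 0
  let s : ModularGroupPCubed p := PresentedGroup.of 1
  have hr : r ^ (p * p) = 1 := by
    have : (QuotientGroup.mk (FreeGroup.of 0 ^ (p ^ 2)) : ModularGroupPCubed p) = 1 :=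
      PresentedGroup.one_of_mem (by simp [modularRelators])
    rw [← pow_two]; exact this
  have hs : s ^ p = 1 :=
    PresentedGroup.one_of_mem (rels := modularRelators p) (x := FreeGroup.of 1 ^ p)
      (by simp [modularRelators])
  have hrs : r⁻¹ * s⁻¹ * r * s = r ^ p := by
    rw [← mul_inv_eq_one]
    exact PresentedGroup.one_of_mem (rels := modularRelators p)
      (x := ((FreeGroup.of 0)⁻¹ * (FreeGroup.of 1)⁻¹ * FreeGroup.of 0 * FreeGroup.of 1) *
        (FreeGroup.of 0 ^ p)⁻¹) (by simp [modularRelators])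
  let f : G →* ModularGroupPCubed p := MonoidHom.mk'
    (fun g => s ^ (φ.val g).val * r ^ (t g).val) (fun g h => by
      rw [normal_form_mul hr hs hrs, ht, H1.val_mul, htred])
  have hf (g : G) : f g = s ^ (φ.val g).val * r ^ (t g).val := rfl
  refine isFiniteQuotient_of_surjective f ?_ ?_ ?_ ?_
  -- Where `ψ = 1` and `φ = 0`, the value of `f` is `r^(1 + pv)`; raising it to the inverse exponent
  -- `1 - pv` recovers `r`.
  · have hrmem : r ∈ f.range := by
      obtain ⟨g, hg, hg'⟩ := hind.exists_dual 1 0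
      have hgr : f g = r ^ (t g).val := by rw [hf, hg']; simp
      obtain ⟨v, hv⟩ := exists_eq_val_add_timesP (t g)
      have hone : t g = 1 + timesP p v := by
        rw [hv, htred, hg, ZMod.val_one]; simp
      have hinv : t g * (1 - timesP p v) = 1 := by
        have : timesP p v * timesP p v = 0 := by
          rw [mul_timesP, reduceP_timesP, zero_mul, map_zero]
        rw [hone]; linear_combination -this
      refine ⟨g ^ (1 - timesP p v).val, ?_⟩
      rw [map_pow, hgr, ← pow_mul]
      conv_rhs => rw [← pow_one r]
      exact pow_eq_pow_of_cast_eq hr (by simpa using hinv)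
    have hsmem : s ∈ f.range := by
      obtain ⟨g, hg, hg'⟩ := hind.exists_dual 0 1
      have hgs : s = f g * (r ^ (t g).val)⁻¹ := by rw [hf, hg', ZMod.val_one]; simp
      rw [hgs]
      exact f.range.mul_mem ⟨g, rfl⟩ (f.range.inv_mem (f.range.pow_mem hrmem _))
    rw [← MonoidHom.range_eq_top, eq_top_iff, ← PresentedGroup.closure_range_of,
      Subgroup.closure_le]
    rintro _ ⟨i, rfl⟩
    fin_cases i
    · exact hrmem
    · exact hsmem
  · exact (isOpen_discrete
      {y : ZMod p × ZMod (p * p) | s ^ y.1.val * r ^ y.2.val = 1}).preimage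
      (φ.continuous_val.prodMk htc)
  · intro h hh
    have h1 := ψ.val_eq_zero_of_mem hh
    have h2 := φ.val_eq_zero_of_mem hh
    obtain ⟨v, hv⟩ := exists_timesP_of_reduceP ((htred h).trans h1)
    have hfh : f h = r ^ (t h).val := by rw [hf, h2]; simp
    rw [map_pow, hfh, ← pow_mul]
    conv_rhs => rw [← pow_zero r]
    refine pow_eq_pow_of_cast_eq hr ?_
    have hz := nsmul_timesP v
    rw [nsmul_eq_mul] at hz
    rw [Nat.cast_mul, ZMod.natCast_zmod_val, hv, Nat.cast_zero, ← hz]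
    exact mul_comm _ _
  · intro h hh g
    have h1 := ψ.val_eq_zero_of_mem hh
    have h2 := φ.val_eq_zero_of_mem hh
    rw [hf, hf, ht, ht, H1.val_mul, H1.val_mul, h1, h2, zero_mul, mul_zero, add_comm (t h),
      add_comm (0 : ZMod p)]

end ModularQuotient

/-! ### Homomorphisms onto the dihedral group of order 8 -/

section DihedralQuotient

/-- The bijection `(ℤ/2)³ → D₄` under which multiplication becomes
`(a, b, c)(a', b', c') = (a + a', b + b', c + c' + ab')`. -/
def dihedralForm (a b c : ZMod 2) : DihedralGroup 4 :=
  DihedralGroup.sr 0 ^ a.val * DihedralGroup.sr 1 ^ b.val *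
    -- The summand `ab` changes the cocycle `ba'`, which the product of reflections alone would
    -- give, into `ab'`.
    DihedralGroup.r (2 * (c.val + a.val * b.val : ℕ) : ZMod 4)

theorem dihedralForm_mul (a b c a' b' c' : ZMod 2) :
    dihedralForm a b c * dihedralForm a' b' c' =
      dihedralForm (a + a') (b + b') (c + c' + a * b') := by
  revert a b c a' b' c'
  decide

theorem dihedralForm_surjective (x : DihedralGroup 4) : ∃ a b c, dihedralForm a b c = x := by
  revert x
  decide

theorem carry_two (a b : ZMod 2) : (carry a b : ZMod 2) = a * b := by
  revert a b
  decide

variable {G : Type*} [Group G] [TopologicalSpace G]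

theorem bockstein_two (ψ : H1 2 G) : bockstein ψ = cup 2 G ψ ψ :=
  congrArg QuotientAddGroup.mk (Subtype.ext (ContinuousMap.ext fun _ => carry_two _ _))

variable [IsTopologicalGroup G]

/-- `D₄` is the group of unitriangular `3 × 3` matrices over `𝔽₂`: a cochain bounding `ψ ∪ φ`
supplies the corner entry above the entries `ψ` and `φ`. -/
theorem isFiniteQuotient_dihedral {ψ φ : H1 2 G} (hind : Independent ψ φ)
    (h : cup 2 G ψ φ = 0) :
    IsFiniteQuotient (G ⧸ descendingCentral 2 G 3) (DihedralGroup 4) := by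
  obtain ⟨u, hu⟩ := (cup_eq_zero_iff ψ φ).mp h
  have hu' (g h : G) : u (g * h) = u g + u h + ψ.val g * φ.val h := by
    have h1 := hu g h
    generalize u (g * h) = x at *
    generalize u g = y at *
    generalize u h = z at *
    generalize ψ.val g = a at *
    generalize φ.val h = b at *
    revert a b x y z
    decide
  let f : G →* DihedralGroup 4 := MonoidHom.mk'
    (fun g => dihedralForm (ψ.val g) (φ.val g) (u g)) (fun g h => by
      rw [dihedralForm_mul, hu', H1.val_mul, H1.val_mul])
  have hf (g : G) : f g = dihedralForm (ψ.val g) (φ.val g) (u g) := rfl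
  have hu1 : u 1 = 0 := by simpa [H1.val_one] using hu' 1 1
  refine isFiniteQuotient_of_surjective f ?_ ?_ ?_ ?_
  · intro x
    obtain ⟨a, b, c, rfl⟩ := dihedralForm_surjective x
    obtain ⟨g, hg, hg'⟩ := hind.exists_dual 1 0
    obtain ⟨h, hh, hh'⟩ := hind.exists_dual 0 1
    obtain ⟨k, hk, hk'⟩ := hind.exists_dual a b
    have hcomm : u (g * h) = u (h * g) + 1 := by
      rw [hu', hu', hg, hh', hh, hg']; ring
    -- A commutator of dual elements maps to the nontrivial central element; multiplying by it
    -- switches the last coordinate.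
    have key : ∃ z, ψ.val z = 0 ∧ φ.val z = 0 ∧ u z = 1 := by
      refine ⟨(h * g)⁻¹ * (g * h), ?_, ?_, ?_⟩
      · simp only [H1.val_mul, H1.val_inv]; ring
      · simp only [H1.val_mul, H1.val_inv]; ring
      · have e : u (h * g * ((h * g)⁻¹ * (g * h))) = u (g * h) := by congr 1; group
        rw [hu', hcomm, H1.val_mul φ, H1.val_mul φ (g), H1.val_inv φ, H1.val_mul φ] at e
        linear_combination e
    obtain ⟨z, hz, hz', hz''⟩ := key
    by_cases hc : u k = c
    · exact ⟨k, by rw [hf, hk, hk', hc]⟩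
    · refine ⟨k * z, ?_⟩
      rw [hf, H1.val_mul, H1.val_mul, hu', hk, hk', hz, hz', hz'', add_zero, add_zero, mul_zero,
        add_zero]
      congr 1
      generalize u k = x at *
      revert x c
      decide
  · exact (isOpen_discrete
      {y : (ZMod 2 × ZMod 2) × ZMod 2 | dihedralForm y.1.1 y.1.2 y.2 = 1}).preimage
      ((ψ.continuous_val.prodMk φ.continuous_val).prodMk u.continuous)
  · intro h hh
    have h1 := ψ.val_eq_zero_of_mem hh
    have h2 := φ.val_eq_zero_of_mem hh
    have hone : f 1 = 1 := map_one f
    rw [hf, H1.val_one, H1.val_one, hu1] at hone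
    rw [hf, pow_two, H1.val_mul, H1.val_mul, hu', h1, h2, mul_zero, add_zero, add_zero,
      CharTwo.add_self_eq_zero, hone]
  · intro h hh g
    have h1 := ψ.val_eq_zero_of_mem hh
    have h2 := φ.val_eq_zero_of_mem hh
    rw [hf, hf, hu', hu', H1.val_mul, H1.val_mul, H1.val_mul, H1.val_mul, h1, h2, zero_mul,
      mul_zero, add_comm (u h), add_comm (0 : ZMod 2), add_comm (0 : ZMod 2)]

end DihedralQuotient


/-! ### Alternating forms on a finite group -/

section Forms

/-- The map `x ↦ ω(x, ·)` has a finite-dimensional image `W`. In coordinates `χ` on `W`, the form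
has matrix `ω(qᵢ, qⱼ)`, where the `qᵢ` lift a basis. Its strictly upper triangular half serves as
`a`, without division by 2. As the `χᵢ` factor through `W`, they vanish on the radical. -/
theorem exists_bilinear_of_alternating {p : ℕ} [Fact p.Prime] {Q : Type*} [Group Q] [Finite Q]
    (ω : Q → Q → ZMod p) (hl : ∀ x y z, ω (x * y) z = ω x z + ω y z)
    (halt : ∀ x, ω x x = 0) (hskew : ∀ x y, ω x y = -ω y x) :
    ∃ (n : ℕ) (a : Fin n → Fin n → ZMod p) (χ : Fin n → Additive Q →+ ZMod p),
      (∀ z, (∀ y, ω z y = 0) → ∀ i, χ i (Additive.ofMul z) = 0) ∧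
      ∀ x y, ∑ i, ∑ j, a i j * (χ i (Additive.ofMul x) * χ j (Additive.ofMul y)) -
        ∑ i, ∑ j, a i j * (χ i (Additive.ofMul y) * χ j (Additive.ofMul x)) = ω x y := by
  let Ω : Additive Q →+ (Q → ZMod p) :=
    AddMonoidHom.mk' (fun x => ω x.toMul) (fun x y => funext fun z => hl _ _ _)
  let W : Submodule (ZMod p) (Q → ZMod p) :=
    { Ω.range with
      smul_mem' := by
        rintro k _ ⟨x, rfl⟩
        refine ⟨k.val • x, ?_⟩
        rw [map_nsmul, ← Nat.cast_smul_eq_nsmul (ZMod p), ZMod.natCast_zmod_val] }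
  let b := Module.finBasis (ZMod p) W
  let n := Module.finrank (ZMod p) W
  let Ω' : Additive Q →+ W :=
    { toFun := fun x => ⟨Ω x, x, rfl⟩
      map_zero' := Subtype.ext (map_zero Ω)
      map_add' := fun x y => Subtype.ext (map_add Ω x y) }
  choose q hq using fun i : Fin n => (b i).2
  let χ : Fin n → Additive Q →+ ZMod p := fun i =>
    ((b.coord i).toAddMonoidHom).comp Ω'
  have hrepr (x y : Q) :
      ω x y = ∑ i, χ i (Additive.ofMul x) * ω (q i).toMul y := by
    have h1 := congrArg (fun v : W => v.1 y) (b.sum_repr (Ω' (Additive.ofMul x)))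
    simp only [Submodule.coe_sum, Submodule.coe_smul, Finset.sum_apply, Pi.smul_apply,
      smul_eq_mul] at h1
    change _ = ω x y at h1
    rw [← h1]
    refine Finset.sum_congr rfl fun i _ => ?_
    rw [← hq i]
    rfl
  have hrepr2 (x y : Q) : ω x y = ∑ i, ∑ j, ω (q i).toMul (q j).toMul *
      (χ i (Additive.ofMul x) * χ j (Additive.ofMul y)) := by
    rw [hrepr x y]
    refine Finset.sum_congr rfl fun i _ => ?_
    rw [hskew, hrepr y, ← Finset.sum_neg_distrib, Finset.mul_sum]
    refine Finset.sum_congr rfl fun j _ => ?_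
    rw [hskew (q j).toMul]
    ring
  refine ⟨n, fun i j => if i < j then ω (q i).toMul (q j).toMul else 0, χ, ?_, ?_⟩
  · intro z hz i
    have : Ω' (Additive.ofMul z) = 0 := Subtype.ext (funext hz)
    change b.coord i (Ω' (Additive.ofMul z)) = 0
    rw [this, map_zero]
  · intro x y
    rw [hrepr2 x y]
    conv_lhs => enter [2]; rw [Finset.sum_comm]
    rw [← Finset.sum_sub_distrib]
    refine Finset.sum_congr rfl fun i _ => ?_
    rw [← Finset.sum_sub_distrib]
    refine Finset.sum_congr rfl fun j _ => ?_
    dsimp only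
    rcases lt_trichotomy i j with h | h | h
    · rw [if_pos h, if_neg h.not_gt]; ring
    · subst h; simp [halt]
    · rw [if_neg h.not_gt, if_pos h, hskew (q i).toMul]; ring

end Forms

/-! ### Twisting a group by a central bilinear form -/

section Twist

/-- The underlying set of `Q`, to be equipped with a twisted multiplication. -/
def Twist (Q : Type*) : Type _ := Q

variable {p : ℕ} {Q : Type*} [Group Q]

/-- If `x y = y x e(B(x, y) - B(y, x))`, where `e : ℤ/p → Q` has central values and `B` is
biadditive and trivial on them, then `x ∘ y = x y e(-B(x, y))` is an abelian group law. -/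
abbrev Twist.commGroup (e : ZMod p → Q) (B : Q → Q → ZMod p)
    (he0 : e 0 = 1) (he : ∀ a b, e (a + b) = e a * e b) (hec : ∀ a x, e a * x = x * e a)
    (hl : ∀ x y z, B (x * y) z = B x z + B y z) (hr : ∀ x y z, B x (y * z) = B x y + B x z)
    (hle : ∀ a x, B (e a) x = 0) (hre : ∀ x a, B x (e a) = 0)
    (hcomm : ∀ x y, x * y = y * x * e (B x y - B y x)) : CommGroup (Twist Q) :=
  letI : Mul (Twist Q) := ⟨fun (x y : Q) => (x * y * e (-B x y) : Q)⟩
  letI : One (Twist Q) := ⟨(1 : Q)⟩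
  letI : Inv (Twist Q) := ⟨fun x : Q => (x⁻¹ * e (-B x x) : Q)⟩
  have hone (x : Q) : B 1 x = 0 := by rw [← he0, hle]
  have hinv (x y : Q) : B x⁻¹ y = -B x y := by
    rw [eq_neg_iff_add_eq_zero, ← hl, inv_mul_cancel, hone]
  { Group.ofLeftAxioms (G := Twist Q)
      (by
        intro (x : Q) (y : Q) (z : Q)
        change ((x * y * e (-B x y)) * z * e (-B (x * y * e (-B x y)) z) : Q) =
          x * (y * z * e (-B y z)) * e (-B x (y * z * e (-B y z)))
        rw [mul_assoc _ (e _) z, hec, hl, hl, hle, hr, hr, hre, add_zero, add_zero]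
        simp only [mul_assoc, ← he]
        congr 4
        ring)
      (by
        intro (x : Q)
        change (1 * x * e (-B 1 x) : Q) = x
        rw [hone, neg_zero, he0, mul_one, one_mul])
      (by
        intro (x : Q)
        change (x⁻¹ * e (-B x x) * x * e (-B (x⁻¹ * e (-B x x)) x) : Q) = 1
        rw [mul_assoc _ (e _) x, hec, hl, hle, hinv, add_zero, ← mul_assoc, inv_mul_cancel,
          one_mul, ← he, neg_neg, neg_add_cancel, he0]) with
    mul_comm := by
      intro (x : Q) (y : Q)
      change (x * y * e (-B x y) : Q) = y * x * e (-B y x)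
      rw [hcomm x y, mul_assoc, ← he]
      congr 2
      ring }

/-- Complex characters separate the points of a finite abelian group, and exponent `n` puts their
values in `μₙ ≅ ℤ/n`. -/
theorem exists_hom_zmod_ne_zero {T : Type*} [CommGroup T] [Finite T] {n : ℕ} [NeZero n]
    (hn : ∀ x : T, x ^ n = 1) {a : T} (ha : a ≠ 1) :
    ∃ u : T → ZMod n, (∀ x y, u (x * y) = u x + u y) ∧ u a ≠ 0 := by
  obtain ⟨φ, hφ⟩ := CommGroup.exists_apply_ne_one_of_hasEnoughRootsOfUnity T ℂ ha
  obtain ⟨ζ, hζ⟩ : ∃ ζ : ℂˣ, IsPrimitiveRoot ζ n :=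
    ⟨_, (Complex.isPrimitiveRoot_exp n (NeZero.ne n)).isUnit_unit (NeZero.ne n)⟩
  have hmem (x : T) : φ x ∈ Subgroup.zpowers ζ := by
    rw [hζ.zpowers_eq, mem_rootsOfUnity, ← map_pow, hn, map_one]
  refine ⟨fun x => hζ.zmodEquivZPowers.symm (Additive.ofMul ⟨φ x, hmem x⟩), ?_, ?_⟩
  · intro x y
    have hxy : (⟨φ (x * y), hmem _⟩ : Subgroup.zpowers ζ) = ⟨φ x, hmem x⟩ * ⟨φ y, hmem y⟩ :=
      Subtype.ext (map_mul φ x y)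
    rw [← map_add, ← ofMul_mul, ← hxy]
  · intro h
    rw [map_eq_zero_iff _ (AddEquiv.injective _)] at h
    exact hφ (congrArg Subtype.val (Additive.ofMul.injective h))

/-- Take a character of the twisted abelian group that is nontrivial on `e 1`. On the values of `e`
it is a nonzero homomorphism `ℤ/p → ℤ/p²`, that is, `b ↦ p k b` with `k ≠ 0`; read on `Q`, it is
additive up to `p k B`. -/
theorem exists_cochain_of_bilinear [Fact p.Prime] [Finite Q] (hexp : ∀ x : Q, x ^ (p * p) = 1)
    (e : ZMod p → Q) (B : Q → Q → ZMod p)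
    (he0 : e 0 = 1) (he : ∀ a b, e (a + b) = e a * e b) (hec : ∀ a x, e a * x = x * e a)
    (hl : ∀ x y z, B (x * y) z = B x z + B y z) (hr : ∀ x y z, B x (y * z) = B x y + B x z)
    (hle : ∀ a x, B (e a) x = 0) (hre : ∀ x a, B x (e a) = 0)
    (hcomm : ∀ x y, x * y = y * x * e (B x y - B y x)) (hne : e 1 ≠ 1) :
    ∃ (u : Q → ZMod (p * p)) (k : ZMod p), k ≠ 0 ∧
      ∀ x y, u (x * y) = u x + u y + timesP p (k * B x y) := by
  let := Twist.commGroup e B he0 he hec hl hr hle hre hcomm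
  have : Finite (Twist Q) := ‹Finite Q›
  let ι : Q → Twist Q := fun x => x
  have hι (x y : Q) : ι x * ι y = ι (x * y * e (-B x y)) := rfl
  have hι1 : ι 1 = 1 := rfl
  have hBpow (x y : Q) (n : ℕ) : B (x ^ n) y = n * B x y := by
    induction n with
    | zero => rw [pow_zero, ← he0, hle]; simp
    | succ n ih => rw [pow_succ, hl, ih]; push_cast; ring
  have hpow (x : Q) (n : ℕ) : ∃ a, ι x ^ n = ι (x ^ n * e a) ∧ (B x x = 0 → a = 0) := by
    induction n with
    | zero => exact ⟨0, by simp [he0, hι1], fun _ => rfl⟩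
    | succ n ih =>
      obtain ⟨a, ha, ha0⟩ := ih
      refine ⟨a + -B (x ^ n * e a) x, ?_, ?_⟩
      · rw [pow_succ, ha, hι, mul_assoc _ (e a), hec, he, pow_succ]
        simp only [mul_assoc]
      · intro h
        rw [ha0 h, hl, hle, hBpow, h]
        simp
  have hepow (a : ZMod p) (n : ℕ) : e a ^ n = e (n * a) := by
    induction n with
    | zero => simp [he0]
    | succ n ih =>
      rw [pow_succ, ih, ← he]
      push_cast
      congr 1
      ring
  -- The twisted `p`-th power of `x` is `x^p e(a)` for some `a`. The form `B` vanishes on this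
  -- element because `pB = 0`, so the next `p`-th power is the untwisted one.
  have hTexp : ∀ x : Twist Q, x ^ (p * p) = 1 := by
    intro (x : Q)
    obtain ⟨a, ha, -⟩ := hpow x p
    have hB : B (x ^ p * e a) (x ^ p * e a) = 0 := by
      rw [hl, hle, hr, hre, hBpow]; simp
    obtain ⟨b, hb, hb0⟩ := hpow (x ^ p * e a) p
    change ι x ^ (p * p) = 1
    rw [pow_mul, ha, hb, hb0 hB, he0, mul_one, Commute.mul_pow (hec a _).symm, ← pow_mul, hexp,
      hepow]
    simp [he0, hι1]
  obtain ⟨u, hu, hune⟩ := exists_hom_zmod_ne_zero hTexp (a := ι (e 1)) hne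
  let v : ZMod p →+ ZMod (p * p) := AddMonoidHom.mk' (fun a => u (ι (e a))) (fun a b => by
    rw [← hu, hι, hre, neg_zero, he0, mul_one, he])
  have hv1 : p • v 1 = 0 := by rw [← map_nsmul]; simp
  have hred : reduceP p (v 1) = 0 := by
    rw [nsmul_eq_mul, ← ZMod.natCast_zmod_val (v 1), ← Nat.cast_mul, ZMod.natCast_eq_zero_iff]
      at hv1
    have h2 := Nat.dvd_of_mul_dvd_mul_left (Nat.pos_of_ne_zero (NeZero.ne p)) hv1
    rwa [← ZMod.natCast_zmod_val (v 1), reduceP_natCast, ZMod.natCast_eq_zero_iff]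
  obtain ⟨k, hk⟩ := exists_timesP_of_reduceP hred
  have hv (b : ZMod p) : v b = timesP p (k * b) := by
    have hb : b = b.val • (1 : ZMod p) := by simp
    conv_lhs => rw [hb, map_nsmul, hk, ← map_nsmul, nsmul_eq_mul, ZMod.natCast_zmod_val, mul_comm b]
  refine ⟨fun x => u (ι x), k, ?_, fun x y => ?_⟩
  · rintro rfl
    exact hune (by rw [map_zero] at hk; exact hk)
  · have h1 := hu (ι x) (ι y)
    have h2 : ι (x * y * e (-B x y)) = ι (x * y) * ι (e (-B x y)) := by
      rw [hι, hre, neg_zero, he0, mul_one]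
    have h3 : u (ι (e (-B x y))) = timesP p (k * -B x y) := hv _
    rw [hι, h2, hu, h3, mul_neg, map_neg] at h1
    linear_combination h1

end Twist


/-! ### A tensor attached to a nonabelian quotient -/

section FiniteGroup

/-- The exponent of `c` in a commutator is an alternating form `ω`, biadditive because `c` is
central. Splitting it as `B(x, y) - B(y, x)` gives the datum for the twist; the asymmetry at `(x₀,
y₀)` is a nonzero multiple of `ω(x₀, y₀)`. -/
theorem exists_form_and_cochain {p : ℕ} [Fact p.Prime] {Q : Type*} [Group Q] [Finite Q] {c : Q}
    (hcc : ∀ x, c * x = x * c) (hcp : c ^ p = 1) (hc1 : c ≠ 1)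
    (hcomm : ∀ x y : Q, x⁻¹ * y⁻¹ * x * y ∈ Subgroup.zpowers c)
    (hexp : ∀ x : Q, x ^ (p * p) = 1) {x₀ y₀ : Q} (hxy : x₀⁻¹ * y₀⁻¹ * x₀ * y₀ = c) :
    ∃ (n : ℕ) (a : Fin n → Fin n → ZMod p) (χ : Fin n → Additive Q →+ ZMod p)
      (u : Q → ZMod (p * p)),
      (∀ x y, u (x * y) = u x + u y + timesP p
        (∑ i, ∑ j, a i j * (χ i (Additive.ofMul x) * χ j (Additive.ofMul y)))) ∧
      ∑ i, ∑ j, a i j * (χ i (Additive.ofMul x₀) * χ j (Additive.ofMul y₀)) ≠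
        ∑ i, ∑ j, a i j * (χ i (Additive.ofMul y₀) * χ j (Additive.ofMul x₀)) := by
  let e : ZMod p → Q := fun a => c ^ a.val
  have he0 : e 0 = 1 := by simp [e]
  have he (a b : ZMod p) : e (a + b) = e a * e b := by
    simp only [e, ← pow_add]
    exact pow_eq_pow_of_cast_eq hcp (by simp)
  have hec (a : ZMod p) (x : Q) : e a * x = x * e a := Commute.pow_left (hcc x) _
  have he1 : e 1 = c := by simp [e, ZMod.val_one]
  have heinj {a b : ZMod p} (h : e a = e b) : a = b := by
    have hord : orderOf c = p := orderOf_eq_prime hcp hc1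
    have := pow_inj_mod.mp h
    rw [hord, Nat.mod_eq_of_lt (ZMod.val_lt a), Nat.mod_eq_of_lt (ZMod.val_lt b)] at this
    exact ZMod.val_injective p this
  have hex (x y : Q) : ∃ a, x⁻¹ * y⁻¹ * x * y = e a := by
    obtain ⟨k, hk⟩ := mem_powers_iff_mem_zpowers.mpr (hcomm x y)
    exact ⟨k, by rw [← hk]; exact pow_eq_pow_of_cast_eq hcp (by simp)⟩
  choose ω hω using hex
  have hω' (x y : Q) : x * y = y * x * e (ω x y) := by rw [← hω]; group
  have hωeq {x y : Q} {a : ZMod p} (h : x * y = y * x * e a) : ω x y = a :=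
    heinj (mul_left_cancel ((hω' x y).symm.trans h))
  have hl (x y z : Q) : ω (x * y) z = ω x z + ω y z := by
    apply hωeq
    rw [mul_assoc, hω' y z, ← mul_assoc, ← mul_assoc, hω' x z, mul_assoc (z * x), hec, he]
    simp only [mul_assoc]
  have halt (x : Q) : ω x x = 0 := hωeq (by rw [he0, mul_one])
  have hskew (x y : Q) : ω x y = -ω y x := by
    apply hωeq
    rw [hω' y x, mul_assoc, ← he, add_neg_cancel, he0, mul_one]
  have hωe (a : ZMod p) (x : Q) : ω (e a) x = 0 := hωeq (by rw [he0, mul_one, hec])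
  obtain ⟨n, a, χ, hχ, hB⟩ := exists_bilinear_of_alternating ω hl halt hskew
  set B : Q → Q → ZMod p := fun x y =>
    ∑ i, ∑ j, a i j * (χ i (Additive.ofMul x) * χ j (Additive.ofMul y)) with hBdef
  have hχe (b : ZMod p) (i : Fin n) : χ i (Additive.ofMul (e b)) = 0 := hχ _ (hωe b) i
  obtain ⟨u, k, hk, hu⟩ := exists_cochain_of_bilinear hexp e B he0 he hec
    (fun x y z => by
      simp only [hBdef, ofMul_mul, map_add, add_mul, mul_add, Finset.sum_add_distrib])
    (fun x y z => by
      simp only [hBdef, ofMul_mul, map_add, mul_add, Finset.sum_add_distrib])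
    (fun b x => by simp [hBdef, hχe]) (fun x b => by simp [hBdef, hχe])
    (fun x y => by
      have : B x y - B y x = ω x y := hB x y
      rw [this, ← hω'])
    (by rwa [he1])
  refine ⟨n, fun i j => k * a i j, χ, u, fun x y => ?_, ?_⟩
  · rw [hu, hBdef]
    simp only [Finset.mul_sum, mul_assoc]
  · intro h
    simp only [mul_assoc, ← Finset.mul_sum] at h
    have h2 := mul_left_cancel₀ hk h
    have h3 := hB x₀ y₀
    rw [h2, sub_self] at h3
    apply hc1
    rw [← hxy, hω, ← h3, he0]

end FiniteGroup

/-! ### From the profinite group to a finite nonabelian quotient and back -/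

section Profinite

variable {p : ℕ} {G : Type*} [Group G] [TopologicalSpace G] [IsTopologicalGroup G]

theorem pow_mem_descendingCentral_two (g : G) : g ^ p ∈ descendingCentral p G 2 :=
  Subgroup.le_topologicalClosure _
    (Subgroup.subset_closure (Or.inl ⟨g, Subgroup.mem_top _, rfl⟩))

theorem commutator_mem_descendingCentral_two (g h : G) :
    g⁻¹ * h⁻¹ * g * h ∈ descendingCentral p G 2 :=
  Subgroup.le_topologicalClosure _
    (Subgroup.subset_closure (Or.inr ⟨g, Subgroup.mem_top _, h, rfl⟩))

theorem pow_mem_descendingCentral_three {g : G} (hg : g ∈ descendingCentral p G 2) :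
    g ^ p ∈ descendingCentral p G 3 :=
  Subgroup.le_topologicalClosure _ (Subgroup.subset_closure (Or.inl ⟨g, hg, rfl⟩))

theorem commutator_mem_descendingCentral_three {g : G} (hg : g ∈ descendingCentral p G 2) (h : G) :
    g⁻¹ * h⁻¹ * g * h ∈ descendingCentral p G 3 :=
  Subgroup.le_topologicalClosure _ (Subgroup.subset_closure (Or.inr ⟨g, hg, h, rfl⟩))

theorem exists_open_normal_not_mem [CompactSpace G] [TotallyDisconnectedSpace G]
    (C : Subgroup G) [C.Normal] (hC : IsClosed (C : Set G)) {x : G} (hx : x ∉ C) :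
    ∃ N : Subgroup G, N.Normal ∧ IsOpen (N : Set G) ∧ C ≤ N ∧ x ∉ N := by
  have hU : IsOpen {g : G | x * g ∉ C} :=
    hC.isOpen_compl.preimage (continuous_const.mul continuous_id)
  obtain ⟨H, hH⟩ := ProfiniteGrp.exist_openNormalSubgroup_sub_open_nhds_of_one hU
    (by simpa using hx)
  have hHn : (H.toSubgroup).Normal := H.isNormal'
  refine ⟨H.toSubgroup ⊔ C, inferInstance, Subgroup.isOpen_mono le_sup_left H.isOpen',
    le_sup_right, fun hmem => ?_⟩
  obtain ⟨h, hh, z, hz, rfl⟩ := Subgroup.mem_sup_of_normal_right.mp hmem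
  have h2 : z⁻¹ * h⁻¹ * z ∈ H.toSubgroup := by
    simpa using hHn.conj_mem _ (H.toSubgroup.inv_mem hh) z⁻¹
  apply hH h2
  have : h * z * (z⁻¹ * h⁻¹ * z) = z := by group
  rwa [this]

/-- A nonabelian quotient of `G / G^(3)` of least order has commutator subgroup of order `p`. -/
theorem exists_minimal_nonabelian [CompactSpace G] [TotallyDisconnectedSpace G]
    (hnonab : ¬ ∀ x y : G ⧸ descendingCentral p G 3, x * y = y * x) :
    ∃ N : Subgroup G, ∃ _ : N.Normal, IsOpen (N : Set G) ∧ descendingCentral p G 3 ≤ N ∧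
      ∃ x y : G, x⁻¹ * y⁻¹ * x * y ∉ N ∧ ∀ g h : G ⧸ N, g⁻¹ * h⁻¹ * g * h ∈
        Subgroup.zpowers ((x⁻¹ * y⁻¹ * x * y : G) : G ⧸ N) := by
  let S : Set (Subgroup G) := {N | N.Normal ∧ IsOpen (N : Set G) ∧ descendingCentral p G 3 ≤ N ∧
    ∃ x y : G, x⁻¹ * y⁻¹ * x * y ∉ N}
  have hS : S.Nonempty := by
    push Not at hnonab
    obtain ⟨x, y, hxy⟩ := hnonab
    obtain ⟨x, rfl⟩ := QuotientGroup.mk_surjective x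
    obtain ⟨y, rfl⟩ := QuotientGroup.mk_surjective y
    have hmem : x⁻¹ * y⁻¹ * x * y ∉ descendingCentral p G 3 := by
      intro h
      apply hxy
      rw [← QuotientGroup.mk_mul, ← QuotientGroup.mk_mul, eq_comm, QuotientGroup.eq]
      convert h using 1
      group
    obtain ⟨N, hN, ho, hle, hn⟩ := exists_open_normal_not_mem (descendingCentral p G 3)
      (Subgroup.isClosed_topologicalClosure _) hmem
    exact ⟨N, hN, ho, hle, x, y, hn⟩
  obtain ⟨N, ⟨hN, ho, hle, x, y, hxy⟩, hmin⟩ :=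
    WellFounded.has_min (measure fun N : Subgroup G => N.index).wf S hS
  refine ⟨N, hN, ho, hle, x, y, hxy, ?_⟩
  set c : G ⧸ N := ((x⁻¹ * y⁻¹ * x * y : G) : G ⧸ N) with hc
  have hc1 : c ≠ 1 := by rwa [hc, Ne, QuotientGroup.eq_one_iff]
  have hcc (g : G ⧸ N) : Commute c g := by
    obtain ⟨g, rfl⟩ := QuotientGroup.mk_surjective g
    change (_ : G ⧸ N) = _
    rw [hc, ← QuotientGroup.mk_mul, ← QuotientGroup.mk_mul, eq_comm, QuotientGroup.eq]
    convert hle (commutator_mem_descendingCentral_three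
      (commutator_mem_descendingCentral_two x y) g) using 1
    group
  have hzn : (Subgroup.zpowers c).Normal := by
    refine ⟨fun n hn g => ?_⟩
    obtain ⟨k, rfl⟩ := Subgroup.mem_zpowers_iff.mp hn
    have : g * c ^ k * g⁻¹ = c ^ k := by
      rw [← ((hcc g).zpow_left k).eq, mul_inv_cancel_right]
    rwa [this]
  have hfin : Finite (G ⧸ N) := N.quotient_finite_of_isOpen ho
  -- A commutator outside `⟨c⟩` would keep the quotient by the preimage of `⟨c⟩` nonabelian, and
  -- that subgroup has smaller index because `c ≠ 1`.
  by_contra hcon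
  push Not at hcon
  obtain ⟨g, h, hgh⟩ := hcon
  obtain ⟨g, rfl⟩ := QuotientGroup.mk_surjective g
  obtain ⟨h, rfl⟩ := QuotientGroup.mk_surjective h
  have hNle : N ≤ (Subgroup.zpowers c).comap (QuotientGroup.mk' N) := by
    intro n hn
    rw [Subgroup.mem_comap, QuotientGroup.mk'_apply, (QuotientGroup.eq_one_iff n).mpr hn]
    exact Subgroup.one_mem _
  refine hmin ((Subgroup.zpowers c).comap (QuotientGroup.mk' N))
    ⟨inferInstance, Subgroup.isOpen_mono hNle ho, hle.trans hNle, g, h, hgh⟩ ?_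
  change Subgroup.index _ < N.index
  rw [Subgroup.index_comap_of_surjective _ (QuotientGroup.mk'_surjective N)]
  have h1 := (Subgroup.zpowers c).card_mul_index
  have h2 : 1 < Nat.card (Subgroup.zpowers c) := by
    rw [Subgroup.one_lt_card_iff_ne_bot, Ne, Subgroup.zpowers_eq_bot]
    exact hc1
  have h3 : 0 < (Subgroup.zpowers c).index := Nat.pos_of_ne_zero Subgroup.index_ne_zero_of_finite
  change _ < Nat.card (G ⧸ N)
  rw [← h1]
  nlinarith

/-- A homomorphism from the quotient by an open normal subgroup, as a class. -/
def H1.ofQuotient (N : Subgroup G) [N.Normal] (hN : IsOpen (N : Set G))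
    (f : G ⧸ N → ZMod p) (hf : ∀ x y, f (x * y) = f x + f y) : H1 p G where
  toFun g := f (QuotientGroup.mk g.toMul)
  map_zero' := by simpa using hf 1 1
  map_add' x y := hf (QuotientGroup.mk x.toMul) (QuotientGroup.mk y.toMul)
  continuous_toFun := by
    have := QuotientGroup.discreteTopology hN
    exact (continuous_of_discreteTopology (f := f)).comp
      (continuous_quotient_mk'.comp continuous_toMul)

/-- Write the cochain as `u = ψ + p w` in base `p`. Its low digit `ψ` is additive; comparing carries
in the additivity formula for `u` shows that `-w` bounds the cocycle of `t` plus the Bockstein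
cocycle of `ψ`. -/
theorem exists_tensor_of_nonabelian [Fact p.Prime] [CompactSpace G] [TotallyDisconnectedSpace G]
    (hnonab : ¬ ∀ x y : G ⧸ descendingCentral p G 3, x * y = y * x) :
    ∃ (t : H1 p G ⊗[ℤ] H1 p G) (ψ : H1 p G), cupTensor p G t + bockstein ψ = 0 ∧
      ∃ x y : G, tensorEval x y t ≠ tensorEval y x t := by
  obtain ⟨N, hN, ho, hle, x, y, hxy, hcomm⟩ := exists_minimal_nonabelian hnonab
  have hfin : Finite (G ⧸ N) := N.quotient_finite_of_isOpen ho
  have hdisc := QuotientGroup.discreteTopology ho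
  obtain ⟨n, a, χ, u, hu, hne⟩ := exists_form_and_cochain (p := p)
    (c := ((x⁻¹ * y⁻¹ * x * y : G) : G ⧸ N)) (x₀ := (x : G ⧸ N)) (y₀ := (y : G ⧸ N))
    (fun g => by
      obtain ⟨g, rfl⟩ := QuotientGroup.mk_surjective g
      rw [← QuotientGroup.mk_mul, ← QuotientGroup.mk_mul, eq_comm, QuotientGroup.eq]
      convert hle (commutator_mem_descendingCentral_three
        (commutator_mem_descendingCentral_two x y) g) using 1
      group)
    (by
      rw [← QuotientGroup.mk_pow, QuotientGroup.eq_one_iff]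
      exact hle (pow_mem_descendingCentral_three (commutator_mem_descendingCentral_two x y)))
    (by rwa [Ne, QuotientGroup.eq_one_iff])
    hcomm
    (fun g => by
      obtain ⟨g, rfl⟩ := QuotientGroup.mk_surjective g
      rw [← QuotientGroup.mk_pow, QuotientGroup.eq_one_iff, pow_mul]
      exact hle (pow_mem_descendingCentral_three (pow_mem_descendingCentral_two g)))
    rfl
  let X : Fin n → H1 p G := fun i =>
    H1.ofQuotient N ho (fun g => χ i (Additive.ofMul g)) (fun g h => map_add (χ i) _ _)
  let ψ : H1 p G := H1.ofQuotient N ho (fun g => reduceP p (u g)) (fun g h => by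
    rw [hu, map_add, map_add, reduceP_timesP, add_zero])
  have hψ (g : G) : ψ.val g = reduceP p (u g) := rfl
  let t : H1 p G ⊗[ℤ] H1 p G := ∑ i, ∑ j, (a i j).val • (X i ⊗ₜ X j)
  have ht (g h : G) : tensorEval g h t = ∑ i, ∑ j, a i j *
      (χ i (Additive.ofMul (g : G ⧸ N)) * χ j (Additive.ofMul (h : G ⧸ N))) := by
    simp only [t, map_sum, map_nsmul, tensorEval_tmul, nsmul_eq_mul, ZMod.natCast_zmod_val]
    rfl
  refine ⟨t, ψ, ?_, x, y, by rwa [ht, ht]⟩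
  choose w hw using fun g : G ⧸ N => exists_eq_val_add_timesP (u g)
  rw [← mk_tensorCocycle]
  refine (mk_eq_zero_iff (tensorCocycle p G t + bocksteinCocycle ψ)).mpr
    ⟨⟨fun g => -w (g : G ⧸ N), ((continuous_of_discreteTopology (f := w)).comp
      continuous_quotient_mk').neg⟩, fun g h => ?_⟩
  change tensorEval g h t + (carry (ψ.val g) (ψ.val h) : ZMod p) =
    -w (h : G ⧸ N) - -w ((g * h : G) : G ⧸ N) + -w (g : G ⧸ N)
  rw [← sub_eq_zero]
  -- The identity is checked in `ℤ/p²`, where carries are differences of representatives.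
  apply timesP_eq_zero
  have h1 := hw ((g * h : G) : G ⧸ N)
  have h2 := hw (g : G ⧸ N)
  have h3 := hw (h : G ⧸ N)
  have h4 := timesP_carry (ψ.val g) (ψ.val h)
  have h5 := hu (g : G ⧸ N) (h : G ⧸ N)
  rw [← ht, ← QuotientGroup.mk_mul] at h5
  rw [← H1.val_mul] at h4
  rw [← hψ] at h1 h2 h3
  simp only [map_add, map_sub, map_neg]
  linear_combination -h5 + h4 + h1 - h2 - h3

end Profinite

end ProfiniteCohomology

end

/-! ### Choosing the independent pair -/

open ProfiniteCohomology in
theorem proposition12p1 (p : ℕ) [Fact p.Prime] (G : Type*) [Group G] [TopologicalSpace G]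
    [IsTopologicalGroup G] [CompactSpace G] [TotallyDisconnectedSpace G]
    (hG : ProfiniteCohomology.HasGaloisRelationType p G)
    (hnonab : ¬ ∀ x y : G ⧸ descendingCentral p G 3, x * y = y * x) :
    (p ≠ 2 → IsFiniteQuotient (G ⧸ descendingCentral p G 3) (ModularGroupPCubed p)) ∧
    (p = 2 → IsFiniteQuotient (G ⧸ descendingCentral p G 3) (DihedralGroup 4)) := by
  obtain ⟨t, ψ, ht, x, y, hxy⟩ := exists_tensor_of_nonabelian hnonab
  obtain ⟨S, hS⟩ := hG.ker_cup
  obtain ⟨ξ, hξ⟩ := hG.bockstein_eq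
  by_cases hind : ∃ φ : H1 p G, Independent φ ξ
  · obtain ⟨φ, hφ⟩ := hind
    refine ⟨fun _ => isFiniteQuotient_modular hφ (hξ φ), ?_⟩
    rintro rfl
    refine isFiniteQuotient_dihedral (ψ := φ) (φ := ξ + φ) ?_ ?_
    · obtain ⟨x, y, hxy⟩ := hφ
      refine ⟨x, y, fun h => hxy ?_⟩
      change φ.val x * (ξ.val y + φ.val y) = φ.val y * (ξ.val x + φ.val x) at h
      linear_combination h
    · rw [map_add, ← bockstein_two]
      exact hξ φ
  · push Not at hind
    have hker : t - ψ ⊗ₜ ξ ∈ (cupTensor p G).ker := by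
      have h1 : cupTensor p G (ψ ⊗ₜ ξ) = cup p G ψ ξ := rfl
      rw [AddMonoidHom.mem_ker, map_sub, h1, eq_neg_of_add_eq_zero_left (hξ ψ), sub_neg_eq_add, ht]
    obtain ⟨s, hs, hsind⟩ : ∃ s ∈ S, Independent s.1 s.2 := by
      by_contra! hcon
      rw [hS] at hker
      have h1 := tensorEval_symm_of_dependent S hcon hker x y
      have h2 := hind ψ
      simp only [Independent, not_exists, not_not] at h2
      simp only [map_sub, tensorEval_tmul, h2 x y, sub_left_inj] at h1
      exact hxy h1
    have hcup : cup p G s.1 s.2 = 0 := by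
      have : s.1 ⊗ₜ[ℤ] s.2 ∈ (cupTensor p G).ker := by
        rw [hS]; exact AddSubgroup.subset_closure ⟨s, hs, rfl⟩
      exact this
    -- If `ξ ≠ 0`, then `s.1` and `s.2`, both dependent on `ξ`, would be multiples of it and so
    -- dependent on each other.
    have hξ0 : ξ = 0 := by
      by_contra hne
      obtain ⟨z, hz⟩ : ∃ z : G, ξ.val z ≠ 0 := by
        by_contra! hcon
        exact hne (ContinuousAddMonoidHom.ext fun g => hcon g.toMul)
      have h1 := hind s.1
      have h2 := hind s.2
      simp only [Independent, not_exists, not_not] at h1 h2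
      obtain ⟨x, y, hxy⟩ := hsind
      apply hxy
      apply mul_right_cancel₀ hz
      apply mul_right_cancel₀ hz
      linear_combination s.2.val y * ξ.val z * h1 x z + s.1.val z * ξ.val x * h2 y z -
        s.2.val x * ξ.val z * h1 y z - s.1.val z * ξ.val y * h2 x z
    refine ⟨fun _ => isFiniteQuotient_modular hsind ?_, ?_⟩
    · have h1 := hξ s.1
      rw [hξ0, map_zero, zero_add] at h1
      rw [hcup, h1, add_zero]
    · rintro rfl
      exact isFiniteQuotient_dihedral hsind hcup
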